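/- A two-qubit state is a positive semidefinite matrix $\rho$ on $\mathbb{C}^2\otimes\mathbb{C}^2$ with $\operatorname{tr}\rho=1$; it is pure if $\rho=|\psi\rangle\langle\psi|$ for a unit vector $\psi$. Let $\sigma_1,\sigma_2,\sigma_3$ be the Pauli matrices, with $\sigma_y=\sigma_2$. The concurrence of $\rho$ is $$C(\rho)=\max\bigl[0,\sqrt{l_1}-\sqrt{l_2}-\sqrt{l_3}-\sqrt{l_4}\bigr],$$ where $l_1\ge l_2\ge l_3\ge l_4$ are the (real, nonnegative) eigenvalues, with algebraic multiplicity, of $\rho(\sigma_y\otimes\sigma_y)\rho^T(\sigma_y\otimes\sigma_y)$, and the maximal CHSH expectation is $\beta(\rho)=\max_{\mathcal B}\operatorname{tr}(\rho\mathcal B)$, where $\mathcal B$ runs over all Bell operators $$\mathcal B=\frac12\sum_{i,j=1}^3\bigl[a_i(c_j+d_j)+b_i(c_j-d_j)\bigr]\sigma_i\otimes\sigma_j$$ with real unit vectors $\vec a,\vec b,\vec c,\vec d\in\mathbb{R}^3$. **Theorem 1.** The maximal violation of the CHSH inequality for given concurrence $C$ is $\sqrt{1+C^2}$. Precisely: 1.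 For every two-qubit state $\rho$, the maximum defining $\beta(\rho)$ is attained, $0\le C(\rho)\le 1$, and $\beta(\rho)\le\sqrt{1+C(\rho)^2}$. 2. Every pure two-qubit state satisfies $\beta(\rho)=\sqrt{1+C(\rho)^2}$. 3. For every $C\in[0,1]$ there is a pure two-qubit state of concurrence $C$, and the largest value of $\beta(\rho)$ over all two-qubit states $\rho$ of concurrence $C$ is $\sqrt{1+C^2}$. -/

import Mathlib

open scoped Kronecker ComplexOrder

noncomputable section

namespace CHSH

/-- The index set of the computational basis `|00⟩, |01⟩, |10⟩, |11⟩` of two qubits. -/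
abbrev TwoQubit : Type := Fin 2 × Fin 2

/-- The Pauli matrices `σ₁ = σ_x`, `σ₂ = σ_y`, `σ₃ = σ_z`, indexed from `0`. -/
def pauli : Fin 3 → Matrix (Fin 2) (Fin 2) ℂ :=
  ![!![0, 1; 1, 0], !![0, -Complex.I; Complex.I, 0], !![1, 0; 0, -1]]

/-- A (possibly mixed) two-qubit state: a density matrix on `ℂ² ⊗ ℂ²`. -/
def IsState (ρ : Matrix TwoQubit TwoQubit ℂ) : Prop :=
  ρ.PosSemidef ∧ ρ.trace = 1

/-- A pure two-qubit state: `ρ = |ψ⟩⟨ψ|` for a unit vector `ψ`. -/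
def IsPureState (ρ : Matrix TwoQubit TwoQubit ℂ) : Prop :=
  ∃ ψ : EuclideanSpace ℂ TwoQubit, ‖ψ‖ = 1 ∧ ∀ i j, ρ i j = ψ i * star (ψ j)

/-- The Bell operator
`½ ∑ᵢⱼ [aᵢ (cⱼ + dⱼ) + bᵢ (cⱼ - dⱼ)] σᵢ ⊗ σⱼ`. -/
def bellOperator (a b c d : EuclideanSpace ℝ (Fin 3)) : Matrix TwoQubit TwoQubit ℂ :=
  (1 / 2 : ℂ) • ∑ i : Fin 3, ∑ j : Fin 3,
    ((a i * (c j + d j) + b i * (c j - d j) : ℝ) : ℂ) • (pauli i ⊗ₖ pauli j)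

/-- The set of all expectation values `tr (ρ B)`, where `B` runs over the Bell operators given by
real unit vectors. The trace is real because `ρ` and `B` are Hermitian. -/
def chshValues (ρ : Matrix TwoQubit TwoQubit ℂ) : Set ℝ :=
  {x | ∃ a b c d : EuclideanSpace ℝ (Fin 3), ‖a‖ = 1 ∧ ‖b‖ = 1 ∧ ‖c‖ = 1 ∧ ‖d‖ = 1 ∧
    x = ((ρ * bellOperator a b c d).trace).re}

/-- The maximal CHSH expectation `β(ρ)`. -/
def maxViolation (ρ : Matrix TwoQubit TwoQubit ℂ) : ℝ := sSup (chshValues ρ)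

/-- The matrix `ρ (σ_y ⊗ σ_y) ρᵀ (σ_y ⊗ σ_y)`. -/
def spinFlipProduct (ρ : Matrix TwoQubit TwoQubit ℂ) : Matrix TwoQubit TwoQubit ℂ :=
  ρ * (pauli 1 ⊗ₖ pauli 1) * ρ.transpose * (pauli 1 ⊗ₖ pauli 1)

/-- The eigenvalues of `ρ (σ_y ⊗ σ_y) ρᵀ (σ_y ⊗ σ_y)` with algebraic multiplicity, in decreasing
order. For a state `ρ` they are real and nonnegative, so taking real parts changes nothing. -/
def spinFlipEigenvalues (ρ : Matrix TwoQubit TwoQubit ℂ) : List ℝ :=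
  ((spinFlipProduct ρ).charpoly.roots.map Complex.re).sort (· ≥ ·)

/-- The concurrence `max [0, √l₁ - √l₂ - √l₃ - √l₄]`, where `l₁ ≥ l₂ ≥ l₃ ≥ l₄` are the
eigenvalues of `ρ (σ_y ⊗ σ_y) ρᵀ (σ_y ⊗ σ_y)`. -/
def concurrence (ρ : Matrix TwoQubit TwoQubit ℂ) : ℝ :=
  max 0 (√((spinFlipEigenvalues ρ).getD 0 0) - (√((spinFlipEigenvalues ρ).getD 1 0)
    + √((spinFlipEigenvalues ρ).getD 2 0) + √((spinFlipEigenvalues ρ).getD 3 0)))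

end CHSH

end

/-! Write `S = pauli 1 ⊗ₖ pauli 1` and `ρ = W Wᴴ`. The numbers `√lᵢ` are the singular values of the
symmetric matrix `Wᵀ S W`, so `C = max 0 (2m - ∑ sᵢ)` with `m` the largest one
(`exists_concurrence_eq`).

Upper bound: the coefficient matrix of a Bell operator has rank at most 2 and Frobenius norm 1. Its
singular value decomposition gives `B = s₁ P₁ + s₂ P₂` with `s₁² + s₂² = 1`, where `P₁`, `P₂` are
commuting products of Pauli observables (`exists_bellOperator_eq`). Their common `+1` eigenvector is
maximally entangled; let `E` project onto it. Positivity of `ρ` on the joint eigenspaces reduces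
everything to `2 tr(ρE) - 1 ≤ C` (`two_mul_re_trace_sub_le_concurrence`), which yields `tr(ρB) ≤ s₁
+ s₂ C ≤ √(1 + C²)`.

The bound on `tr(ρE)` comes from testing `Wᵀ S W` against one unitary of Householder type: it loses
at most `2m` from the sum of singular values, yet makes the contribution of `E` equal to `-tr(ρE)`.

Equality for pure states: in the Schmidt basis `C = 2 s₀ s₁`, and explicit directions give `(1 +
C²)/√(1 + C²)`. -/

/-! ### Linear algebra: singular values and a Householder-type unitary. -/

open Matrix in
/-- Singular value decomposition of a square matrix. -/
theorem Matrix.exists_svd {𝕜 n : Type*} [RCLike 𝕜] [Fintype n] [DecidableEq n]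
    (A : Matrix n n 𝕜) :
    ∃ (U V : Matrix n n 𝕜) (s : n → ℝ), U * Uᴴ = 1 ∧ Uᴴ * U = 1 ∧ V * Vᴴ = 1 ∧ Vᴴ * V = 1 ∧
      (∀ i, 0 ≤ s i) ∧ A = U * diagonal (fun i => (s i : 𝕜)) * Vᴴ := by
  have hH : (Aᴴ * A).IsHermitian := isHermitian_conjTranspose_mul_self A
  have hP : (Aᴴ * A).PosSemidef := posSemidef_conjTranspose_mul_self A
  set V : Matrix n n 𝕜 := (hH.eigenvectorUnitary).1 with hV
  have hV1 : V * Vᴴ = 1 := Unitary.coe_mul_star_self hH.eigenvectorUnitary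
  have hV2 : Vᴴ * V = 1 := Unitary.coe_star_mul_self hH.eigenvectorUnitary
  set s : n → ℝ := fun i => √(hH.eigenvalues i) with hs
  have hs2 : ∀ i, s i * s i = hH.eigenvalues i := fun i =>
    Real.mul_self_sqrt (hP.eigenvalues_nonneg i)
  have hsp : Aᴴ * A = V * diagonal (fun i => (hH.eigenvalues i : 𝕜)) * Vᴴ := hH.spectral_theorem
  have hG : (A * V)ᴴ * (A * V) = diagonal (fun i => ((s i * s i : ℝ) : 𝕜)) := by
    rw [conjTranspose_mul, Matrix.mul_assoc, ← Matrix.mul_assoc Aᴴ, hsp]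
    simp only [hs2, Matrix.mul_assoc, hV2, Matrix.mul_one]
    rw [← Matrix.mul_assoc, hV2, Matrix.one_mul]
  -- The columns of `A * V` are orthogonal of length `s i`. Where `s i = 0` the quotient is the junk
  -- value 0; such indices are excluded from `horth` and filled in by extending to a basis.
  let v : n → EuclideanSpace 𝕜 n := fun i => WithLp.toLp 2 (fun k => (A * V) k i / (s i : 𝕜))
  have hinner : ∀ i j, inner 𝕜 (v i) (v j)
      = ((A * V)ᴴ * (A * V)) i j / ((s i : 𝕜) * (s j : 𝕜)) := by
    intro i j
    simp only [v, PiLp.inner_apply, Matrix.mul_apply (M := (A * V)ᴴ), Finset.sum_div,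
      RCLike.inner_apply, conjTranspose_apply, map_div₀, RCLike.conj_ofReal, RCLike.star_def]
    refine Finset.sum_congr rfl fun k _ => ?_
    rw [div_mul_div_comm, mul_comm, mul_comm (s j : 𝕜)]
  have horth : Orthonormal 𝕜 (({i | s i ≠ 0} : Set n).domRestrict v) := by
    rw [orthonormal_iff_ite]
    rintro ⟨i, hi⟩ ⟨j, hj⟩
    rw [Set.domRestrict_apply, Set.domRestrict_apply, hinner, hG]
    simp only [Subtype.mk.injEq]
    by_cases h : i = j
    · subst h
      have : (s i : 𝕜) ≠ 0 := by exact_mod_cast hi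
      simp [this]
    · simp [h]
  obtain ⟨b, hb⟩ := horth.exists_orthonormalBasis_extension_of_card_eq (by simp)
  let U : Matrix n n 𝕜 := fun k i => b i k
  have hU : Uᴴ * U = 1 := by
    ext i j
    have := orthonormal_iff_ite.1 b.orthonormal i j
    simp only [PiLp.inner_apply, RCLike.inner_apply] at this
    rw [Matrix.one_apply, ← this, Matrix.mul_apply]
    exact Finset.sum_congr rfl fun k _ => mul_comm _ _
  refine ⟨U, V, s, mul_eq_one_comm.1 hU, hU, hV1, hV2, fun i => Real.sqrt_nonneg _, ?_⟩
  have hAV : A * V = U * diagonal (fun i => (s i : 𝕜)) := by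
    ext k i
    rw [mul_diagonal]
    by_cases hi : s i = 0
    · have h0 := congrFun (congrFun hG i) i
      rw [Matrix.mul_apply, diagonal_apply_eq, hi] at h0
      simp only [conjTranspose_apply, mul_zero, RCLike.ofReal_zero,
        RCLike.star_def, RCLike.conj_mul] at h0
      have h1 : ∑ x, ‖(A * V) x i‖ ^ 2 = 0 := by exact_mod_cast h0
      have h2 := (Finset.sum_eq_zero_iff_of_nonneg (fun _ _ => by positivity)).1 h1 k
        (Finset.mem_univ k)
      have h3 : (A * V) k i = 0 := by simpa using h2
      rw [h3, hi]; simp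
    · have : (s i : 𝕜) ≠ 0 := by exact_mod_cast hi
      simp only [U, hb i hi, v]
      field_simp
  rw [← hAV, Matrix.mul_assoc, hV1, Matrix.mul_one]

open Matrix in
/-- A unitary of Householder type that sends `x` to `-y`, and almost maximizes the overlap with a
nonnegative diagonal matrix. -/
theorem Matrix.exists_unitary_mulVec_eq_neg {n : Type*} [Fintype n] [DecidableEq n]
    (x y : n → ℂ) (hxy : star x ⬝ᵥ x = star y ⬝ᵥ y) (s : n → ℝ) (m : ℝ)
    (hm : ∀ i, s i ≤ m) (hm0 : 0 ≤ m) :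
    ∃ K : Matrix n n ℂ, Kᴴ * K = 1 ∧ K *ᵥ x = -y ∧
      ∑ i, s i - 2 * m ≤ (K * diagonal (fun i => (s i : ℂ))).trace.re := by
  -- For `K = 1 - κ⁻¹ w wᴴ`, the definition of `κ` gives `K x = x - w = -y`. Unitarity amounts to
  -- `wᴴ w = κ + star κ`, which is where the equal lengths of `x` and `y` enter.
  set w := x + y with hw
  set κ := star w ⬝ᵥ x with hκ
  have hww : star w ⬝ᵥ w = κ + star κ := by
    have h1 : star κ = star x ⬝ᵥ w := by rw [hκ, star_dotProduct, star_star, dotProduct_comm]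
    rw [h1, hκ, hw]
    simp only [star_add, dotProduct_add, add_dotProduct, hxy]
    ring
  have hwr : star w ⬝ᵥ w = ((∑ i, ‖w i‖ ^ 2 : ℝ) : ℂ) := by
    simp only [dotProduct, Pi.star_apply, RCLike.star_def, Complex.conj_mul', Complex.ofReal_sum,
      Complex.ofReal_pow]
  have hre : ∑ i, ‖w i‖ ^ 2 = 2 * κ.re := by
    have := congrArg Complex.re (hwr.symm.trans hww)
    rw [Complex.ofReal_re] at this
    rw [this]; simp; ring
  by_cases hκ0 : κ = 0
  · have hw0 : w = 0 := by
      refine dotProduct_star_self_eq_zero.1 ?_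
      rw [hww, hκ0]; simp
    refine ⟨1, by simp, ?_, ?_⟩
    · rw [one_mulVec]; exact eq_neg_of_add_eq_zero_left hw0
    · simp only [Matrix.one_mul, trace_diagonal, Complex.re_sum, Complex.ofReal_re]; linarith
  · have hκs : star κ ≠ 0 := by simpa using hκ0
    refine ⟨1 - κ⁻¹ • vecMulVec w (star w), ?_, ?_, ?_⟩
    · have hmul : vecMulVec w (star w) * vecMulVec w (star w)
          = (κ + star κ) • vecMulVec w (star w) := by
        rw [vecMulVec_mul_vecMulVec, hww, vecMulVec_smul]
      have hct : (vecMulVec w (star w))ᴴ = vecMulVec w (star w) := by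
        rw [conjTranspose_vecMulVec, star_star]
      rw [conjTranspose_sub, conjTranspose_smul, hct, conjTranspose_one, Matrix.sub_mul,
        Matrix.mul_sub, Matrix.mul_sub, Matrix.smul_mul (star κ⁻¹), Matrix.smul_mul (star κ⁻¹)]
      simp only [Matrix.mul_smul, hmul, Matrix.mul_one, Matrix.one_mul, smul_smul, star_inv₀]
      rw [sub_sub, ← add_sub_assoc, ← add_smul, ← sub_smul]
      have : κ⁻¹ + (star κ)⁻¹ - (star κ)⁻¹ * (κ⁻¹ * (κ + star κ)) = 0 := by
        field_simp; ring
      rw [this, zero_smul, sub_zero]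
    · rw [sub_mulVec, one_mulVec, smul_mulVec, vecMulVec_mulVec, ← hκ]
      ext i
      simp [hw, hκ0]
    · have htr : ((1 - κ⁻¹ • vecMulVec w (star w)) * diagonal (fun i => (s i : ℂ))).trace.re
          = ∑ i, s i - (κ⁻¹).re * ∑ i, s i * ‖w i‖ ^ 2 := by
        rw [Matrix.sub_mul, Matrix.one_mul, trace_sub, trace_diagonal, Matrix.smul_mul,
          trace_smul]
        have : (vecMulVec w (star w) * diagonal (fun i => (s i : ℂ))).trace
            = ((∑ i, s i * ‖w i‖ ^ 2 : ℝ) : ℂ) := by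
          simp only [trace, diag_apply, mul_diagonal, vecMulVec_apply]
          push_cast
          refine Finset.sum_congr rfl fun i _ => ?_
          rw [← Complex.mul_conj']
          simp [mul_comm]
        rw [this, smul_eq_mul, Complex.sub_re, Complex.re_mul_ofReal]
        simp
      rw [htr]
      have hκre : 0 ≤ κ.re := by
        have : 0 ≤ ∑ i, ‖w i‖ ^ 2 := by positivity
        linarith
      have hn : 0 < Complex.normSq κ := Complex.normSq_pos.2 hκ0
      have h1 : ∑ i, s i * ‖w i‖ ^ 2 ≤ m * (2 * κ.re) := by
        rw [← hre, Finset.mul_sum]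
        exact Finset.sum_le_sum fun i _ => mul_le_mul_of_nonneg_right (hm i) (by positivity)
      -- With `‖w‖² = 2 Re κ` and `Re κ⁻¹ = Re κ / |κ|²`, the loss is at most `2m (Re κ)² / |κ|²`.
      have h2 : (κ⁻¹).re * ∑ i, s i * ‖w i‖ ^ 2 ≤ 2 * m := by
        rw [Complex.inv_re]
        calc κ.re / Complex.normSq κ * ∑ i, s i * ‖w i‖ ^ 2
            ≤ κ.re / Complex.normSq κ * (m * (2 * κ.re)) :=
              mul_le_mul_of_nonneg_left h1 (by positivity)
          _ = 2 * m * (κ.re * κ.re / Complex.normSq κ) := by ring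
          _ ≤ 2 * m * 1 := by
              refine mul_le_mul_of_nonneg_left ?_ (by positivity)
              rw [div_le_one hn, Complex.normSq_apply]
              nlinarith [mul_self_nonneg κ.im]
          _ = 2 * m := by ring
      linarith

namespace CHSH

open Matrix

/-! ### Concurrence through singular values, and its bounds. -/

theorem spinFlip_conjTranspose : (pauli 1 ⊗ₖ pauli 1)ᴴ = pauli 1 ⊗ₖ pauli 1 := by
  ext ⟨i, j⟩ ⟨k, l⟩
  fin_cases i <;> fin_cases j <;> fin_cases k <;> fin_cases l <;> simp [pauli]

theorem spinFlip_mul_self : (pauli 1 ⊗ₖ pauli 1) * (pauli 1 ⊗ₖ pauli 1) = 1 := by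
  have : pauli 1 * pauli 1 = 1 := by
    ext i j
    fin_cases i <;> fin_cases j <;> simp [pauli, Matrix.mul_apply]
  rw [← mul_kronecker_mul, this, one_kronecker_one]

/-- The sorted list of squares, in terms of the sum and the maximum. -/
theorem sqrt_getD_sort_sq (s : TwoQubit → ℝ) (hs : ∀ i, 0 ≤ s i) (l : List ℝ)
    (hl : l = (Finset.univ.val.map (fun i => s i ^ 2)).sort (· ≥ ·)) :
    (∀ i, s i ≤ √(l.getD 0 0)) ∧ (∃ i, √(l.getD 0 0) = s i) ∧
      √(l.getD 0 0) + (√(l.getD 1 0) + √(l.getD 2 0) + √(l.getD 3 0)) = ∑ i, s i := by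
  have hcoe : (l : Multiset ℝ) = Finset.univ.val.map (fun i => s i ^ 2) := by
    rw [hl, Multiset.sort_eq]
  have hlen : l.length = 4 := by
    rw [hl, Multiset.length_sort, Multiset.card_map]; rfl
  have hsort : l.Pairwise (· ≥ ·) := by rw [hl]; exact Multiset.pairwise_sort _ _
  have hsqrt : (l.map Real.sqrt : Multiset ℝ) = Finset.univ.val.map s := by
    rw [← Multiset.map_coe, hcoe, Multiset.map_map]
    exact Multiset.map_congr rfl fun i _ => Real.sqrt_sq (hs i)
  obtain ⟨a, b, c, d, rfl⟩ : ∃ a b c d, l = [a, b, c, d] := by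
    match l, hlen with
    | [a, b, c, d], _ => exact ⟨a, b, c, d, rfl⟩
  have hmax : ∀ x ∈ [a, b, c, d], x ≤ a := by
    simp only [List.pairwise_cons, List.mem_cons] at hsort ⊢
    rintro x (rfl | h)
    · exact le_rfl
    · exact hsort.1 x (by simpa using h)
  simp only [List.getD_cons_zero, List.getD_cons_succ]
  refine ⟨fun i => ?_, ?_, ?_⟩
  · have : s i ^ 2 ∈ ([a, b, c, d] : Multiset ℝ) := by
      rw [hcoe]; exact Multiset.mem_map_of_mem _ (Finset.mem_univ i)
    exact Real.le_sqrt_of_sq_le (hmax _ this)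
  · have : √a ∈ (([a, b, c, d].map Real.sqrt : List ℝ) : Multiset ℝ) := by simp
    rw [hsqrt, Multiset.mem_map] at this
    obtain ⟨i, -, hi⟩ := this
    exact ⟨i, hi.symm⟩
  · have := congrArg Multiset.sum hsqrt
    rw [Multiset.sum_coe] at this
    simp only [List.map_cons, List.map_nil, List.sum_cons, List.sum_nil, add_zero] at this
    rw [Finset.sum, ← this]; ring

/-- The concurrence in terms of the singular values of `Wᵀ (σ_y ⊗ σ_y) W`, where `ρ = W Wᴴ`. -/
theorem exists_concurrence_eq (W U V : Matrix TwoQubit TwoQubit ℂ) (s : TwoQubit → ℝ)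
    (hs : ∀ i, 0 ≤ s i) (hU : Uᴴ * U = 1) (hV : Vᴴ * V = 1)
    (hτ : Wᵀ * (pauli 1 ⊗ₖ pauli 1) * W = U * diagonal (fun i => (s i : ℂ)) * Vᴴ) :
    ∃ m, (∀ i, s i ≤ m) ∧ (∃ i, m = s i) ∧
      concurrence (W * Wᴴ) = max 0 (2 * m - ∑ i, s i) := by
  -- Moving `W` around cyclically turns the spin-flip product into `τᴴ τ` with `τ = Wᵀ S W`, whose
  -- eigenvalues are the `s i ^ 2`.
  have hchar : (spinFlipProduct (W * Wᴴ)).charpoly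
      = (diagonal (fun i => ((s i ^ 2 : ℝ) : ℂ))).charpoly := by
    have h1 : spinFlipProduct (W * Wᴴ) = W * (Wᴴ * (pauli 1 ⊗ₖ pauli 1) * Wᵀᴴ
        * (Wᵀ * (pauli 1 ⊗ₖ pauli 1))) := by
      have h0 : Wᴴᵀ = Wᵀᴴ := rfl
      rw [spinFlipProduct, transpose_mul, h0]
      simp only [Matrix.mul_assoc]
    have h2 : Wᴴ * (pauli 1 ⊗ₖ pauli 1) * Wᵀᴴ
        = (Wᵀ * (pauli 1 ⊗ₖ pauli 1) * W)ᴴ := by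
      rw [conjTranspose_mul, conjTranspose_mul, spinFlip_conjTranspose, Matrix.mul_assoc]
    rw [h1, charpoly_mul_comm, Matrix.mul_assoc, h2, hτ, conjTranspose_mul, conjTranspose_mul,
      conjTranspose_conjTranspose, Matrix.mul_assoc V, charpoly_mul_comm]
    congr 1
    calc _ = (diagonal fun i => (s i : ℂ))ᴴ * (Uᴴ * U) * (diagonal fun i => (s i : ℂ))
          * (Vᴴ * V) := by simp only [Matrix.mul_assoc]
      _ = _ := by
        rw [hU, hV, Matrix.mul_one, Matrix.mul_one, diagonal_conjTranspose, diagonal_mul_diagonal]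
        congr 1; ext i; simp [sq]
  have hroots : (spinFlipProduct (W * Wᴴ)).charpoly.roots.map Complex.re
      = Finset.univ.val.map (fun i => s i ^ 2) := by
    have hmap := Multiset.map_map (fun a : ℂ => Polynomial.X - Polynomial.C a)
      (fun i : TwoQubit => ((s i ^ 2 : ℝ) : ℂ)) Finset.univ.val
    simp only [Function.comp_def] at hmap
    rw [hchar, charpoly_diagonal, Finset.prod_eq_multiset_prod, ← hmap,
      Polynomial.roots_multiset_prod_X_sub_C, Multiset.map_map]
    exact Multiset.map_congr rfl fun i _ => Complex.ofReal_re _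
  obtain ⟨h1, h2, h3⟩ := sqrt_getD_sort_sq s hs (spinFlipEigenvalues (W * Wᴴ))
    (by rw [spinFlipEigenvalues, hroots])
  refine ⟨_, h1, h2, ?_⟩
  rw [concurrence, ← h3]
  congr 1; ring

/-- A Hermitian idempotent matrix of trace one is the projection onto a line. -/
theorem exists_eq_vecMulVec_of_trace_eq_one {n : Type*} [Fintype n] [DecidableEq n]
    (E : Matrix n n ℂ) (hE : Eᴴ = E) (hE2 : E * E = E) (hE1 : E.trace = 1) :
    ∃ e : n → ℂ, star e ⬝ᵥ e = 1 ∧ E = vecMulVec e (star e) := by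
  obtain ⟨v, hv⟩ : ∃ v, E *ᵥ v ≠ 0 := by
    by_contra! h
    have : E = 0 := by
      apply Matrix.ext_of_mulVec_single
      intro i
      rw [h, zero_mulVec]
    simp [this] at hE1
  set w := E *ᵥ v with hw
  have hEw : E *ᵥ w = w := by rw [hw, mulVec_mulVec, hE2]
  set N : ℝ := ∑ i, ‖w i‖ ^ 2 with hN
  have hwr : star w ⬝ᵥ w = (N : ℂ) := by
    simp only [hN, dotProduct, Pi.star_apply, RCLike.star_def, Complex.conj_mul',
      Complex.ofReal_sum, Complex.ofReal_pow]
  have hN0 : 0 ≤ N := by positivity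
  have hNne : N ≠ 0 := by
    intro h
    rw [h, Complex.ofReal_zero] at hwr
    exact hv (dotProduct_star_self_eq_zero.1 hwr)
  set e : n → ℂ := ((√N : ℝ) : ℂ)⁻¹ • w with he
  have hs : ((√N : ℝ) : ℂ) * ((√N : ℝ) : ℂ) = N := by exact_mod_cast Real.mul_self_sqrt hN0
  have hsne : ((√N : ℝ) : ℂ) ≠ 0 := by
    intro h; rw [h] at hs; rw [mul_zero] at hs; exact hNne (by exact_mod_cast hs.symm)
  have hee : star e ⬝ᵥ e = 1 := by
    rw [he, star_smul, smul_dotProduct, dotProduct_smul, hwr, ← hs]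
    simp only [star_inv₀, RCLike.star_def, Complex.conj_ofReal, smul_eq_mul]
    field_simp
  have hEe : E *ᵥ e = e := by rw [he, mulVec_smul, hEw]
  have hEe' : star e ᵥ* E = star e := by
    have := congrArg star hEe
    rwa [star_mulVec, hE] at this
  -- The difference `E - e eᴴ` is again a Hermitian idempotent, so its squared Hilbert–Schmidt norm
  -- is its trace, which is 0.
  refine ⟨e, hee, sub_eq_zero.1 (trace_conjTranspose_mul_self_eq_zero_iff.1 ?_)⟩
  have hid : (E - vecMulVec e (star e))ᴴ * (E - vecMulVec e (star e))
      = E - vecMulVec e (star e) := by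
    rw [conjTranspose_sub, conjTranspose_vecMulVec, star_star, hE, Matrix.sub_mul, Matrix.mul_sub,
      Matrix.mul_sub, hE2, mul_vecMulVec, vecMulVec_mul, vecMulVec_mul_vecMulVec, hEe, hEe', hee,
      one_smul]
    abel
  rw [hid, trace_sub, hE1, trace_vecMulVec, dotProduct_comm, hee, sub_self]

open scoped MatrixOrder in
theorem exists_eq_mul_conjTranspose {ρ : Matrix TwoQubit TwoQubit ℂ} (hρ : ρ.PosSemidef) :
    ∃ W, ρ = W * Wᴴ := by
  obtain ⟨B, hB⟩ := CStarAlgebra.nonneg_iff_eq_star_mul_self.1 hρ.nonneg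
  exact ⟨Bᴴ, by rw [hB, conjTranspose_conjTranspose]; rfl⟩

theorem two_mul_re_trace_conjTranspose_mul_le {n : Type*} [Fintype n] (A B : Matrix n n ℂ) :
    2 * (Aᴴ * B).trace.re ≤ (Aᴴ * A).trace.re + (Bᴴ * B).trace.re := by
  have h := (posSemidef_conjTranspose_mul_self (A - B)).trace_nonneg
  have h1 : (Bᴴ * A).trace.re = (Aᴴ * B).trace.re := by
    have : (Bᴴ * A).trace = star (Aᴴ * B).trace := by
      rw [← trace_conjTranspose, conjTranspose_mul, conjTranspose_conjTranspose]
    rw [this]; simp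
  have h2 := (Complex.le_def.1 h).1
  rw [conjTranspose_sub, Matrix.sub_mul, Matrix.mul_sub, Matrix.mul_sub] at h2
  simp only [trace_sub, Complex.sub_re, Complex.zero_re] at h2
  linarith

/-- The trace is the Hilbert–Schmidt pairing of `(K Yᵀ)ᴴ` with `S Y`; since `K` and `S` are unitary,
both have squared norm `tr (Yᴴ Y)`. -/
theorem re_trace_mul_spinFlip_le (K Y : Matrix TwoQubit TwoQubit ℂ) (hK : Kᴴ * K = 1) :
    (K * (Yᵀ * (pauli 1 ⊗ₖ pauli 1) * Y)).trace.re ≤ (Yᴴ * Y).trace.re := by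
  have h := two_mul_re_trace_conjTranspose_mul_le (K * Yᵀ)ᴴ ((pauli 1 ⊗ₖ pauli 1) * Y)
  have h1 : ((K * Yᵀ) * (K * Yᵀ)ᴴ).trace.re = (Yᴴ * Y).trace.re := by
    rw [trace_mul_comm, conjTranspose_mul, Matrix.mul_assoc, ← Matrix.mul_assoc Kᴴ, hK,
      Matrix.one_mul, ← trace_transpose, transpose_mul, transpose_transpose, trace_mul_comm]
    have : Yᵀᴴᵀ = Yᴴ := rfl
    rw [this]
  have h2 : ((pauli 1 ⊗ₖ pauli 1) * Y)ᴴ * ((pauli 1 ⊗ₖ pauli 1) * Y) = Yᴴ * Y := by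
    rw [conjTranspose_mul, spinFlip_conjTranspose, Matrix.mul_assoc,
      ← Matrix.mul_assoc (pauli 1 ⊗ₖ pauli 1), spinFlip_mul_self, Matrix.one_mul]
  rw [conjTranspose_conjTranspose, h1, h2] at h
  simp only [Matrix.mul_assoc] at h ⊢
  linarith

/-- Overlaps with a maximally entangled state bound the concurrence from below. -/
theorem two_mul_re_trace_sub_le_concurrence {ρ : Matrix TwoQubit TwoQubit ℂ} (hρ : ρ.PosSemidef)
    (E : Matrix TwoQubit TwoQubit ℂ) (hE : Eᴴ = E) (hE2 : E * E = E) (hE1 : E.trace = 1)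
    (hSE : (pauli 1 ⊗ₖ pauli 1) * E = Eᵀ * (pauli 1 ⊗ₖ pauli 1)) :
    2 * (ρ * E).trace.re - ρ.trace.re ≤ concurrence ρ := by
  obtain ⟨W, rfl⟩ := exists_eq_mul_conjTranspose hρ
  obtain ⟨U, V, s, hU, hU', hV, hV', hs, hτ⟩ :=
    Matrix.exists_svd (Wᵀ * (pauli 1 ⊗ₖ pauli 1) * W)
  obtain ⟨m, hm, ⟨j, hj⟩, hC⟩ := exists_concurrence_eq W U V s hs hU' hV' hτ
  obtain ⟨e, he, rfl⟩ := exists_eq_vecMulVec_of_trace_eq_one E hE hE2 hE1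
  set S := pauli 1 ⊗ₖ pauli 1 with hS
  set E := vecMulVec e (star e) with hEdef
  -- `S e = ω ē` with a phase `ω`
  have hSe : S *ᵥ e = (e ⬝ᵥ (S *ᵥ e)) • star e := by
    have h1 := congrArg (· *ᵥ e) hSE
    simp only [hEdef, ← mulVec_mulVec, vecMulVec_mulVec, he, transpose_vecMulVec] at h1
    simpa [mulVec_smul] using h1
  set ω := e ⬝ᵥ (S *ᵥ e) with hω
  have hωn : star ω * ω = 1 := by
    have h1 : star (S *ᵥ e) ⬝ᵥ (S *ᵥ e) = 1 := by
      rw [star_mulVec, spinFlip_conjTranspose, ← dotProduct_mulVec, mulVec_mulVec,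
        spinFlip_mul_self, one_mulVec, he]
    rw [hSe, star_smul, star_star, smul_dotProduct, dotProduct_smul, dotProduct_comm, he] at h1
    simpa using h1
  set r := star e ᵥ* W with hr
  -- the Householder unitary
  obtain ⟨K, hK, hKr, hKs⟩ := Matrix.exists_unitary_mulVec_eq_neg (Uᴴ *ᵥ (ω • r)) (Vᴴ *ᵥ star r)
    (by
      have hiso : ∀ (T : Matrix TwoQubit TwoQubit ℂ) (v : TwoQubit → ℂ), T * Tᴴ = 1 →
          star (Tᴴ *ᵥ v) ⬝ᵥ (Tᴴ *ᵥ v) = star v ⬝ᵥ v := by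
        intro T v hT
        rw [star_mulVec, conjTranspose_conjTranspose, ← dotProduct_mulVec, mulVec_mulVec, hT,
          one_mulVec]
      rw [hiso U _ hU, hiso V _ hV, star_star, star_smul, smul_dotProduct, dotProduct_smul,
        smul_smul, smul_eq_mul, hωn, one_mul, dotProduct_comm])
    s m hm (hj ▸ hs j)
  -- Undoing the singular bases transfers both properties of `K` to `Wᵀ S W`: the trace against `K'`
  -- stays at least `∑ sᵢ - 2m`, while `ω r` goes to `-star r`.
  set K' := V * K * Uᴴ with hK'
  have hK'u : K'ᴴ * K' = 1 := by
    calc K'ᴴ * K' = U * (Kᴴ * (Vᴴ * V) * K) * Uᴴ := by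
          simp only [hK', conjTranspose_mul, conjTranspose_conjTranspose, Matrix.mul_assoc]
      _ = 1 := by rw [hV', Matrix.mul_one, hK, Matrix.mul_one, hU]
  have hK'r : K' *ᵥ (ω • r) = - star r := by
    rw [hK', ← mulVec_mulVec, ← mulVec_mulVec, hKr, mulVec_neg, mulVec_mulVec, hV, one_mulVec]
  have hK's : ∑ i, s i - 2 * m ≤ (K' * (Wᵀ * S * W)).trace.re := by
    have : (K' * (Wᵀ * S * W)).trace = (K * diagonal (fun i => (s i : ℂ))).trace := by
      calc (K' * (Wᵀ * S * W)).trace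
          = (V * (K * (Uᴴ * U) * diagonal (fun i => (s i : ℂ)) * Vᴴ)).trace := by
            rw [hτ, hK']; simp only [Matrix.mul_assoc]; rfl
        _ = _ := by rw [trace_mul_comm, hU', Matrix.mul_one, Matrix.mul_assoc, hV', Matrix.mul_one]
    rw [this]; exact hKs
  have h3 : (1 - E) * (1 - E) = 1 - E := by
    rw [Matrix.mul_sub, Matrix.sub_mul 1 E E, hE2]; simp
  -- Because `S E = Eᵀ S`, the cross terms between `E` and `1 - E` vanish; the `E` part has rank
  -- one.
  have hsplit : Wᵀ * S * W = ((1 - E) * W)ᵀ * S * ((1 - E) * W) + ω • vecMulVec r r := by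
    have h1 : S * E = ω • vecMulVec (star e) (star e) := by
      rw [hEdef, mul_vecMulVec, hSe, smul_vecMulVec]
    have h2 : ((1 - E) * W)ᵀ * S * ((1 - E) * W) = Wᵀ * (S * ((1 - E) * (1 - E))) * W := by
      rw [transpose_mul, transpose_sub, transpose_one]
      have : (1 - Eᵀ) * S = S * (1 - E) := by
        rw [Matrix.sub_mul, Matrix.mul_sub, hSE, Matrix.one_mul, Matrix.mul_one]
      calc _ = Wᵀ * ((1 - Eᵀ) * S) * ((1 - E) * W) := by simp only [Matrix.mul_assoc]
        _ = _ := by rw [this]; simp only [Matrix.mul_assoc]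
    have h4 : Wᵀ * (S * E) * W = ω • vecMulVec r r := by
      rw [h1, Matrix.mul_smul, Matrix.smul_mul, mul_vecMulVec, vecMulVec_mul, mulVec_transpose]
    rw [h2, h3, Matrix.mul_sub, Matrix.mul_one, Matrix.mul_sub, Matrix.sub_mul, h4]
    abel
  have hle := re_trace_mul_spinFlip_le K' ((1 - E) * W) hK'u
  have hrr : (W * Wᴴ * E).trace = star r ⬝ᵥ r := by
    rw [hEdef, mul_vecMulVec, trace_vecMulVec, hr, star_vecMul, star_star, ← mulVec_mulVec,
      dotProduct_comm, dotProduct_mulVec, dotProduct_comm]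
  have hlast : (K' * (ω • vecMulVec r r)).trace = -(W * Wᴴ * E).trace := by
    rw [hrr, ← smul_vecMulVec, mul_vecMulVec, hK'r, trace_vecMulVec, neg_dotProduct]
  have hfirst : (((1 - E) * W)ᴴ * ((1 - E) * W)).trace = (W * Wᴴ).trace - (W * Wᴴ * E).trace := by
    have h4 : (1 - E)ᴴ = 1 - E := by rw [conjTranspose_sub, conjTranspose_one, hE]
    calc (((1 - E) * W)ᴴ * ((1 - E) * W)).trace = (Wᴴ * (((1 - E) * (1 - E)) * W)).trace := by
          rw [conjTranspose_mul, h4]; simp only [Matrix.mul_assoc]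
      _ = _ := by
        rw [h3, trace_mul_comm, Matrix.mul_assoc, trace_mul_comm, Matrix.mul_sub, Matrix.mul_one,
          trace_sub]
  rw [hsplit, Matrix.mul_add, trace_add, hlast, Complex.add_re, Complex.neg_re] at hK's
  rw [hfirst, Complex.sub_re] at hle
  rw [hC]
  refine le_max_of_le_right ?_
  linarith

theorem concurrence_mem_Icc {ρ : Matrix TwoQubit TwoQubit ℂ} (hρ : IsState ρ) :
    concurrence ρ ∈ Set.Icc (0 : ℝ) 1 := by
  refine ⟨le_max_left _ _, ?_⟩
  obtain ⟨hρ, htr⟩ := hρ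
  obtain ⟨W, rfl⟩ := exists_eq_mul_conjTranspose hρ
  obtain ⟨U, V, s, hU, hU', hV, hV', hs, hτ⟩ :=
    Matrix.exists_svd (Wᵀ * (pauli 1 ⊗ₖ pauli 1) * W)
  obtain ⟨m, hm, ⟨j, hj⟩, hC⟩ := exists_concurrence_eq W U V s hs hU' hV' hτ
  -- This unitary cancels the singular bases, so the trace becomes `∑ sᵢ`, which is therefore at
  -- most `tr ρ = 1`.
  have hle := re_trace_mul_spinFlip_le (V * Uᴴ) W (by
    rw [conjTranspose_mul, conjTranspose_conjTranspose, Matrix.mul_assoc, ← Matrix.mul_assoc Vᴴ,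
      hV', Matrix.one_mul, hU])
  have htrs : (V * Uᴴ * (Wᵀ * (pauli 1 ⊗ₖ pauli 1) * W)).trace = ((∑ i, s i : ℝ) : ℂ) := by
    calc _ = (V * ((Uᴴ * U) * diagonal (fun i => (s i : ℂ)) * Vᴴ)).trace := by
          rw [hτ]; simp only [Matrix.mul_assoc]; rfl
      _ = _ := by
        rw [trace_mul_comm, hU', Matrix.one_mul, Matrix.mul_assoc, hV', Matrix.mul_one,
          trace_diagonal, Complex.ofReal_sum]
  rw [htrs, Complex.ofReal_re, trace_mul_comm, htr, Complex.one_re] at hle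
  have := Finset.single_le_sum (fun i _ => hs i) (Finset.mem_univ j)
  rw [hC]
  exact max_le zero_le_one (by linarith)

/-! ### Calculus of Pauli vectors. -/

/-- The matrix `u · σ` of a real vector `u`. -/
noncomputable def pauliVec (u : Fin 3 → ℝ) : Matrix (Fin 2) (Fin 2) ℂ := ∑ i, (u i : ℂ) • pauli i

theorem pauliVec_eq (u : Fin 3 → ℝ) :
    pauliVec u = !![(u 2 : ℂ), u 0 - u 1 * Complex.I; u 0 + u 1 * Complex.I, -u 2] := by
  ext i j
  fin_cases i <;> fin_cases j <;> simp [pauliVec, pauli, Fin.sum_univ_three]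
  ring

theorem pauliVec_add (u v : Fin 3 → ℝ) : pauliVec (u + v) = pauliVec u + pauliVec v := by
  simp [pauliVec, add_smul, Finset.sum_add_distrib]

theorem pauliVec_sub (u v : Fin 3 → ℝ) : pauliVec (u - v) = pauliVec u - pauliVec v := by
  simp [pauliVec, sub_smul, Finset.sum_sub_distrib]

theorem pauliVec_conjTranspose (u : Fin 3 → ℝ) : (pauliVec u)ᴴ = pauliVec u := by
  rw [pauliVec_eq]
  ext i j
  fin_cases i <;> fin_cases j <;> simp [sub_eq_add_neg]

theorem trace_pauliVec (u : Fin 3 → ℝ) : (pauliVec u).trace = 0 := by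
  simp [pauliVec_eq, trace_fin_two]

theorem pauliVec_mul_add_mul (u v : Fin 3 → ℝ) :
    pauliVec u * pauliVec v + pauliVec v * pauliVec u = ((2 * (u ⬝ᵥ v) : ℝ) : ℂ) • 1 := by
  rw [pauliVec_eq, pauliVec_eq]
  ext i j
  fin_cases i <;> fin_cases j <;>
    simp [dotProduct, Fin.sum_univ_three] <;> ring_nf <;> simp

theorem pauliVec_mul_self (u : Fin 3 → ℝ) (hu : u ⬝ᵥ u = 1) : pauliVec u * pauliVec u = 1 := by
  have h := pauliVec_mul_add_mul u u
  rw [hu, ← two_smul ℂ (pauliVec u * pauliVec u)] at h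
  have : (2 : ℂ) ≠ 0 := two_ne_zero
  simpa using (smul_right_injective _ this) (h.trans (by simp))

theorem pauliVec_mul_comm (u v : Fin 3 → ℝ) (huv : u ⬝ᵥ v = 0) :
    pauliVec u * pauliVec v = -(pauliVec v * pauliVec u) := by
  have h := pauliVec_mul_add_mul u v
  rw [huv] at h
  exact eq_neg_of_add_eq_zero_left (by simpa using h)

theorem trace_pauliVec_mul (u v : Fin 3 → ℝ) (huv : u ⬝ᵥ v = 0) :
    (pauliVec u * pauliVec v).trace = 0 := by
  have h := congrArg trace (pauliVec_mul_comm u v huv)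
  rw [trace_neg, trace_mul_comm (pauliVec v)] at h
  exact self_eq_neg.1 h

/-- Spin flip reverses every Pauli vector. In a tensor product of two the signs cancel, which gives
the symmetry `S P = Pᵀ S` needed for the concurrence bound. -/
theorem pauli_one_mul_pauliVec (u : Fin 3 → ℝ) :
    pauli 1 * pauliVec u = -((pauliVec u)ᵀ * pauli 1) := by
  rw [pauliVec_eq]
  ext i j
  fin_cases i <;> fin_cases j <;> simp [pauli, Matrix.mul_apply] <;> ring

theorem exists_eq_pauliVec (X : Matrix (Fin 2) (Fin 2) ℂ) (hX : Xᴴ = X) (htr : X.trace = 0)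
    (hX2 : X * X = 1) : ∃ u : Fin 3 → ℝ, u ⬝ᵥ u = 1 ∧ pauliVec u = X := by
  have h00 : star (X 0 0) = X 0 0 := congrFun (congrFun hX 0) 0
  have h01 : star (X 1 0) = X 0 1 := congrFun (congrFun hX 0) 1
  rw [trace_fin_two] at htr
  have h11 : X 1 1 = - X 0 0 := eq_neg_of_add_eq_zero_right htr
  have hre : (((X 0 0).re : ℝ) : ℂ) = X 0 0 := Complex.conj_eq_iff_re.1 h00
  set u : Fin 3 → ℝ := ![(X 1 0).re, (X 1 0).im, (X 0 0).re] with hu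
  have hXu : pauliVec u = X := by
    rw [pauliVec_eq]
    ext i j
    fin_cases i <;> fin_cases j
    · simp [hu, hre]
    · simp only [hu, Fin.zero_eta, Fin.mk_one, ← h01]
      apply Complex.ext <;> simp
    · simp [hu]
    · simp [hu, hre, h11]
  refine ⟨u, ?_, hXu⟩
  have h := pauliVec_mul_add_mul u u
  rw [hXu, hX2] at h
  have := congrArg Complex.re (congrFun (congrFun h 0) 0)
  simp at this
  linarith

/-- Conjugation preserves Hermitian traceless involutions, and these are exactly the unit Pauli
vectors: local unitaries act as rotations of measurement directions. -/
theorem exists_pauliVec_conj (U : Matrix (Fin 2) (Fin 2) ℂ) (hU : U * Uᴴ = 1) (hU' : Uᴴ * U = 1)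
    (u : Fin 3 → ℝ) (hu : u ⬝ᵥ u = 1) :
    ∃ v : Fin 3 → ℝ, v ⬝ᵥ v = 1 ∧ pauliVec v = U * pauliVec u * Uᴴ := by
  refine exists_eq_pauliVec _ ?_ ?_ ?_
  · simp only [conjTranspose_mul, conjTranspose_conjTranspose, pauliVec_conjTranspose,
      Matrix.mul_assoc]
  · rw [trace_mul_comm, ← Matrix.mul_assoc, hU', Matrix.one_mul, trace_pauliVec]
  · calc _ = U * (pauliVec u * (Uᴴ * U) * pauliVec u) * Uᴴ := by simp only [Matrix.mul_assoc]
      _ = 1 := by rw [hU', Matrix.mul_one, pauliVec_mul_self u hu, Matrix.mul_one, hU]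

/-! ### Correlation matrices and the normal form of Bell operators. -/

/-- The operator `∑ Mᵢⱼ σᵢ ⊗ σⱼ`. -/
noncomputable def correlator (M : Matrix (Fin 3) (Fin 3) ℝ) : Matrix TwoQubit TwoQubit ℂ :=
  ∑ i, ∑ j, (M i j : ℂ) • (pauli i ⊗ₖ pauli j)

theorem correlator_add (M N : Matrix (Fin 3) (Fin 3) ℝ) :
    correlator (M + N) = correlator M + correlator N := by
  simp [correlator, add_smul, Finset.sum_add_distrib]

theorem correlator_smul (t : ℝ) (M : Matrix (Fin 3) (Fin 3) ℝ) :
    correlator (t • M) = (t : ℂ) • correlator M := by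
  simp only [correlator, Finset.smul_sum, smul_smul, Matrix.smul_apply, smul_eq_mul,
    Complex.ofReal_mul]

theorem correlator_vecMulVec (u v : Fin 3 → ℝ) :
    correlator (vecMulVec u v) = pauliVec u ⊗ₖ pauliVec v := by
  ext ⟨i, j⟩ ⟨k, l⟩
  simp only [correlator, pauliVec, Matrix.sum_apply, Matrix.smul_apply, kroneckerMap_apply,
    vecMulVec_apply, Finset.sum_mul_sum, smul_eq_mul]
  refine Finset.sum_congr rfl fun x _ => Finset.sum_congr rfl fun y _ => ?_
  push_cast
  ring

theorem bellOperator_eq_correlator (a b c d : EuclideanSpace ℝ (Fin 3)) :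
    bellOperator a b c d = correlator (fun i j =>
      (1 / 2) * (a i * (c j + d j) + b i * (c j - d j))) := by
  simp only [bellOperator, correlator, Finset.smul_sum, smul_smul]
  refine Finset.sum_congr rfl fun x _ => Finset.sum_congr rfl fun y _ => ?_
  push_cast
  rfl

theorem bellOperator_eq (a b c d : EuclideanSpace ℝ (Fin 3)) :
    bellOperator a b c d = (1 / 2 : ℂ) • (pauliVec a ⊗ₖ (pauliVec c + pauliVec d)
      + pauliVec b ⊗ₖ (pauliVec c - pauliVec d)) := by
  rw [← pauliVec_add, ← pauliVec_sub, ← correlator_vecMulVec, ← correlator_vecMulVec,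
    ← correlator_add, bellOperator_eq_correlator]
  have := correlator_smul (1 / 2) (vecMulVec a.ofLp (c.ofLp + d.ofLp)
    + vecMulVec b.ofLp (c.ofLp - d.ofLp))
  push_cast at this
  rw [← this]
  rfl

theorem norm_eq_one_iff_dotProduct (a : EuclideanSpace ℝ (Fin 3)) :
    ‖a‖ = 1 ↔ a.ofLp ⬝ᵥ a.ofLp = 1 := by
  rw [EuclideanSpace.norm_eq, Real.sqrt_eq_one]
  simp [dotProduct, sq]

/-- Every Bell operator is `s₁ (u₁σ) ⊗ (v₁σ) + s₂ (u₂σ) ⊗ (v₂σ)` for orthonormal pairs. -/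
theorem exists_bellOperator_eq (a b c d : EuclideanSpace ℝ (Fin 3)) (ha : ‖a‖ = 1) (hb : ‖b‖ = 1)
    (hc : ‖c‖ = 1) (hd : ‖d‖ = 1) :
    ∃ (s₁ s₂ : ℝ) (u₁ u₂ v₁ v₂ : Fin 3 → ℝ), 0 ≤ s₂ ∧ s₂ ≤ s₁ ∧ s₁ ^ 2 + s₂ ^ 2 = 1 ∧
      u₁ ⬝ᵥ u₁ = 1 ∧ u₂ ⬝ᵥ u₂ = 1 ∧ u₁ ⬝ᵥ u₂ = 0 ∧ v₁ ⬝ᵥ v₁ = 1 ∧ v₂ ⬝ᵥ v₂ = 1 ∧ v₁ ⬝ᵥ v₂ = 0 ∧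
      bellOperator a b c d = (s₁ : ℂ) • (pauliVec u₁ ⊗ₖ pauliVec v₁)
        + (s₂ : ℂ) • (pauliVec u₂ ⊗ₖ pauliVec v₂) := by
  rw [norm_eq_one_iff_dotProduct] at ha hb hc hd
  set M : Matrix (Fin 3) (Fin 3) ℝ := fun i j =>
    (1 / 2) * (a i * (c j + d j) + b i * (c j - d j)) with hM
  obtain ⟨U, V, s, hU, hU', hV, hV', hs, hMs⟩ := M.exists_svd
  simp only [RCLike.ofReal_real_eq_id, id_eq, conjTranspose_eq_transpose_of_trivial] at *
  -- `M` is a sum of two rank-one matrices of size 3, so some singular value vanishes.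
  have hdet : M.det = 0 := by
    rw [det_fin_three]; simp only [hM]; ring
  have hprod : ∏ i, s i = 0 := by
    have hu : U.det ≠ 0 := fun h => by simpa [h] using congrArg det hU
    have hv : V.det ≠ 0 := fun h => by simpa [h] using congrArg det hV
    rw [hMs, det_mul, det_mul, det_diagonal, det_transpose] at hdet
    simpa [hu, hv] using hdet
  -- The squared Frobenius norm is `(|c+d|² + |c-d|² + 2 (a·b)(|c|² - |d|²)) / 4 = 1`.
  have hsum : ∑ i, s i ^ 2 = 1 := by
    have h1 : (Mᵀ * M).trace = ∑ i, s i ^ 2 := by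
      calc (Mᵀ * M).trace = (V * (diagonal s * (Uᵀ * U) * diagonal s * Vᵀ)).trace := by
            rw [hMs]; simp only [transpose_mul, transpose_transpose, diagonal_transpose,
              Matrix.mul_assoc]
        _ = _ := by
          rw [trace_mul_comm, Matrix.mul_assoc, hV', hU', Matrix.mul_one, Matrix.mul_one,
            diagonal_mul_diagonal, trace_diagonal]
          simp [sq]
    rw [← h1]
    have hMij : ∀ i j, M i j = (1 / 2) * (a i * (c j + d j) + b i * (c j - d j)) := fun _ _ => rfl
    simp only [trace, diag_apply, Matrix.mul_apply, transpose_apply, Fin.sum_univ_three]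
    simp only [hMij]
    simp only [dotProduct, Fin.sum_univ_three] at ha hb hc hd
    linear_combination
      (1 / 4) * ((c 0 + d 0) ^ 2 + (c 1 + d 1) ^ 2 + (c 2 + d 2) ^ 2) * ha
      + (1 / 4) * ((c 0 - d 0) ^ 2 + (c 1 - d 1) ^ 2 + (c 2 - d 2) ^ 2) * hb
      + (1 / 2) * (a 0 * b 0 + a 1 * b 1 + a 2 * b 2 + 1) * hc
      + (1 / 2) * (1 - (a 0 * b 0 + a 1 * b 1 + a 2 * b 2)) * hd
  have hdecomp : M = ∑ k, s k • vecMulVec (fun i => U i k) (fun j => V j k) := by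
    ext i j
    rw [hMs, Matrix.mul_apply]
    simp only [mul_diagonal, transpose_apply, Matrix.sum_apply, Matrix.smul_apply,
      vecMulVec_apply, smul_eq_mul]
    exact Finset.sum_congr rfl fun k _ => by ring
  have hcol : ∀ T : Matrix (Fin 3) (Fin 3) ℝ, Tᵀ * T = 1 → ∀ i j,
      (fun k => T k i) ⬝ᵥ (fun k => T k j) = if i = j then 1 else 0 := by
    intro T hT i j
    rw [← Matrix.one_apply, ← hT]; rfl
  -- The order is increasing: `e 0` carries the zero singular value and `e 2` the largest.
  set e := Tuple.sort s
  have hmono : Monotone (s ∘ e) := Tuple.monotone_sort s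
  have h01 : s (e 0) ≤ s (e 1) := hmono (by decide)
  have h12 : s (e 1) ≤ s (e 2) := hmono (by decide)
  rw [← Equiv.prod_comp e, Fin.prod_univ_three] at hprod
  rw [← Equiv.sum_comp e, Fin.sum_univ_three] at hsum
  rw [← Equiv.sum_comp e, Fin.sum_univ_three] at hdecomp
  have h0 : s (e 0) = 0 := by
    have h0 := hs (e 0)
    rcases mul_eq_zero.1 hprod with h | h
    · rcases mul_eq_zero.1 h with h | h
      · exact h
      · linarith
    · linarith
  rw [h0, zero_smul, zero_add] at hdecomp
  rw [h0] at hsum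
  refine ⟨s (e 2), s (e 1), fun i => U i (e 2), fun i => U i (e 1), fun i => V i (e 2),
    fun i => V i (e 1), hs _, h12, by linarith, ?_, ?_, ?_, ?_, ?_, ?_, ?_⟩
  pick_goal 7
  · rw [bellOperator_eq_correlator, ← hM, hdecomp, add_comm, correlator_add, correlator_smul,
      correlator_smul, correlator_vecMulVec, correlator_vecMulVec]
  all_goals
    rw [hcol _ (by assumption)]
    simp

/-! ### The upper bound for all states. -/

theorem re_trace_mul_nonneg {ρ Q : Matrix TwoQubit TwoQubit ℂ} (hρ : ρ.PosSemidef) (hQ : Qᴴ = Q)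
    (hQ2 : Q * Q = Q) : 0 ≤ (ρ * Q).trace.re := by
  have h := (hρ.conjTranspose_mul_mul_same Q).trace_nonneg
  rw [hQ, trace_mul_comm, ← Matrix.mul_assoc, hQ2, trace_mul_comm] at h
  exact (Complex.le_def.1 h).1

/-- Upper bound for `s₁ (2 Q₁ - 1) + s₂ (2 Q₂ - 1)`, where `Q₁`, `Q₂` are commuting projections whose
product is the projection onto a maximally entangled state. -/
theorem re_trace_mul_add_le {ρ Q₁ Q₂ : Matrix TwoQubit TwoQubit ℂ} (hρ : IsState ρ)
    (h1 : Q₁ᴴ = Q₁) (h1' : Q₁ * Q₁ = Q₁) (h2 : Q₂ᴴ = Q₂) (h2' : Q₂ * Q₂ = Q₂)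
    (hcomm : Q₁ * Q₂ = Q₂ * Q₁) (htr : (Q₁ * Q₂).trace = 1)
    (hS1 : (pauli 1 ⊗ₖ pauli 1) * Q₁ = Q₁ᵀ * (pauli 1 ⊗ₖ pauli 1))
    (hS2 : (pauli 1 ⊗ₖ pauli 1) * Q₂ = Q₂ᵀ * (pauli 1 ⊗ₖ pauli 1))
    {s₁ s₂ : ℝ} (hs2 : 0 ≤ s₂) (hs : s₂ ≤ s₁) (hss : s₁ ^ 2 + s₂ ^ 2 = 1) :
    s₁ * (2 * (ρ * Q₁).trace.re - 1) + s₂ * (2 * (ρ * Q₂).trace.re - 1)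
      ≤ √(1 + concurrence ρ ^ 2) := by
  obtain ⟨hpos, hone⟩ := hρ
  have hE : (Q₁ * Q₂)ᴴ = Q₁ * Q₂ := by rw [conjTranspose_mul, h1, h2, hcomm]
  have hE2 : (Q₁ * Q₂) * (Q₁ * Q₂) = Q₁ * Q₂ := by
    calc (Q₁ * Q₂) * (Q₁ * Q₂) = Q₁ * (Q₂ * Q₁) * Q₂ := by simp only [Matrix.mul_assoc]
      _ = (Q₁ * Q₁) * (Q₂ * Q₂) := by rw [← hcomm]; simp only [Matrix.mul_assoc]
      _ = Q₁ * Q₂ := by rw [h1', h2']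
  have hSE : (pauli 1 ⊗ₖ pauli 1) * (Q₁ * Q₂) = (Q₁ * Q₂)ᵀ * (pauli 1 ⊗ₖ pauli 1) := by
    rw [← Matrix.mul_assoc, hS1, Matrix.mul_assoc, hS2, ← Matrix.mul_assoc, ← transpose_mul,
      ← hcomm]
  have hC := two_mul_re_trace_sub_le_concurrence hpos _ hE hE2 htr hSE
  rw [hone, Complex.one_re] at hC
  have hle1 : 0 ≤ 1 - (ρ * Q₁).trace.re := by
    have := re_trace_mul_nonneg hpos (Q := 1 - Q₁) (by rw [conjTranspose_sub, h1]; simp)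
      (by rw [Matrix.mul_sub, Matrix.sub_mul 1 Q₁ Q₁, h1']; simp)
    rwa [Matrix.mul_sub, trace_sub, Matrix.mul_one, hone, Complex.sub_re, Complex.one_re] at this
  -- This is the expectation of the projection `(1 - Q₁)(1 - Q₂)`.
  have hle2 : 0 ≤ 1 - (ρ * Q₁).trace.re - (ρ * Q₂).trace.re + (ρ * (Q₁ * Q₂)).trace.re := by
    have hF : (1 - Q₁) * (1 - Q₂) = 1 - Q₁ - Q₂ + Q₁ * Q₂ := by
      rw [Matrix.mul_sub, Matrix.mul_one, Matrix.sub_mul, Matrix.one_mul]; abel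
    have hR : Q₁ * (1 - Q₁ - Q₂ + Q₁ * Q₂) = 0 := by
      rw [Matrix.mul_add, Matrix.mul_sub, Matrix.mul_sub, h1', ← Matrix.mul_assoc, h1',
        Matrix.mul_one]; abel
    have hR2 : Q₂ * (1 - Q₁ - Q₂ + Q₁ * Q₂) = 0 := by
      rw [Matrix.mul_add, Matrix.mul_sub, Matrix.mul_sub, h2', hcomm, ← Matrix.mul_assoc, h2',
        Matrix.mul_one]; abel
    have := re_trace_mul_nonneg hpos (Q := 1 - Q₁ - Q₂ + Q₁ * Q₂)
      (by rw [conjTranspose_add, hE, conjTranspose_sub, conjTranspose_sub, h1, h2]; simp)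
      (by
        rw [Matrix.add_mul, Matrix.sub_mul, Matrix.sub_mul, Matrix.mul_assoc Q₁, hR, hR2,
          Matrix.mul_zero, Matrix.one_mul]; abel)
    rwa [Matrix.mul_add, Matrix.mul_sub, Matrix.mul_sub, trace_add, trace_sub, trace_sub,
      Matrix.mul_one, hone, Complex.add_re, Complex.sub_re, Complex.sub_re, Complex.one_re] at this
  -- Writing `qᵢ = tr(ρQᵢ)`, the left side is `(s₁ - s₂)(2q₁ - 1) + 2s₂(q₁ + q₂ - 1)`, where `q₁ ≤
  -- 1`, `q₁ + q₂ - 1 ≤ tr(ρQ₁Q₂)` and `2 tr(ρQ₁Q₂) ≤ 1 + C`.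
  have hlin : s₁ * (2 * (ρ * Q₁).trace.re - 1) + s₂ * (2 * (ρ * Q₂).trace.re - 1)
      ≤ s₁ + s₂ * concurrence ρ := by
    have e1 := mul_le_mul_of_nonneg_left hC hs2
    have e2 := mul_nonneg hs2 hle2
    have e3 := mul_le_mul_of_nonneg_right hs hle1
    linarith
  refine hlin.trans (Real.le_sqrt_of_sq_le ?_)
  -- Cauchy–Schwarz: `(s₁ + s₂ C)² + (s₁ C - s₂)² = (s₁² + s₂²)(1 + C²)`.
  nlinarith [sq_nonneg (s₁ * concurrence ρ - s₂)]

theorem re_trace_mul_bellOperator_le {ρ : Matrix TwoQubit TwoQubit ℂ} (hρ : IsState ρ)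
    {a b c d : EuclideanSpace ℝ (Fin 3)} (ha : ‖a‖ = 1) (hb : ‖b‖ = 1) (hc : ‖c‖ = 1)
    (hd : ‖d‖ = 1) : ((ρ * bellOperator a b c d).trace).re ≤ √(1 + concurrence ρ ^ 2) := by
  obtain ⟨s₁, s₂, u₁, u₂, v₁, v₂, hs2, hs, hss, hu1, hu2, hu, hv1, hv2, hv, hB⟩ :=
    exists_bellOperator_eq a b c d ha hb hc hd
  have key : ∀ u v : Fin 3 → ℝ, u ⬝ᵥ u = 1 → v ⬝ᵥ v = 1 →
      ∃ Q : Matrix TwoQubit TwoQubit ℂ, Qᴴ = Q ∧ Q * Q = Q ∧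
        (pauli 1 ⊗ₖ pauli 1) * Q = Qᵀ * (pauli 1 ⊗ₖ pauli 1) ∧
        Q = (1 / 2 : ℂ) • (1 + pauliVec u ⊗ₖ pauliVec v) := by
    intro u v hu hv
    set P := pauliVec u ⊗ₖ pauliVec v with hP
    have hP2 : P * P = 1 := by
      rw [hP, ← mul_kronecker_mul, pauliVec_mul_self u hu, pauliVec_mul_self v hv,
        one_kronecker_one]
    refine ⟨_, ?_, ?_, ?_, rfl⟩
    · rw [conjTranspose_smul, conjTranspose_add, hP, conjTranspose_kronecker,
        pauliVec_conjTranspose, pauliVec_conjTranspose]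
      simp
    · rw [smul_mul_smul_comm, Matrix.mul_add, Matrix.add_mul, Matrix.add_mul, hP2, Matrix.mul_one,
        Matrix.one_mul, Matrix.mul_one, add_comm P 1, ← two_smul ℂ, smul_smul]
      norm_num
    · have : (pauli 1 ⊗ₖ pauli 1) * P = Pᵀ * (pauli 1 ⊗ₖ pauli 1) := by
        rw [hP, ← mul_kronecker_mul, pauli_one_mul_pauliVec, pauli_one_mul_pauliVec,
          ← kroneckerMap_transpose, ← mul_kronecker_mul]
        ext ⟨i, j⟩ ⟨k, l⟩
        simp only [kroneckerMap_apply, Matrix.neg_apply, neg_mul_neg]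
      rw [Matrix.mul_smul, transpose_smul, Matrix.smul_mul, Matrix.mul_add, transpose_add,
        Matrix.add_mul, this, transpose_one, Matrix.mul_one, Matrix.one_mul]
  obtain ⟨Q₁, h1, h1', hS1, hQ1⟩ := key u₁ v₁ hu1 hv1
  obtain ⟨Q₂, h2, h2', hS2, hQ2⟩ := key u₂ v₂ hu2 hv2
  set P₁ := pauliVec u₁ ⊗ₖ pauliVec v₁ with hP1
  set P₂ := pauliVec u₂ ⊗ₖ pauliVec v₂ with hP2
  -- Orthogonal Pauli vectors anticommute in each tensor factor, and the two signs cancel.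
  have hPP : P₁ * P₂ = P₂ * P₁ := by
    rw [hP1, hP2, ← mul_kronecker_mul, ← mul_kronecker_mul, pauliVec_mul_comm u₁ u₂ hu,
      pauliVec_mul_comm v₁ v₂ hv]
    ext ⟨i, j⟩ ⟨k, l⟩
    simp only [kroneckerMap_apply, Matrix.neg_apply, neg_mul_neg]
  have hcomm : Q₁ * Q₂ = Q₂ * Q₁ := by
    rw [hQ1, hQ2, smul_mul_smul_comm, smul_mul_smul_comm]
    congr 1
    rw [Matrix.mul_add, Matrix.mul_add, Matrix.add_mul, Matrix.add_mul, Matrix.add_mul,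
      Matrix.add_mul, hPP]
    simp only [Matrix.mul_one, Matrix.one_mul]
    abel
  have htr : (Q₁ * Q₂).trace = 1 := by
    have t1 : P₁.trace = 0 := by rw [hP1, trace_kronecker, trace_pauliVec, zero_mul]
    have t2 : P₂.trace = 0 := by rw [hP2, trace_kronecker, trace_pauliVec, zero_mul]
    have t3 : (P₁ * P₂).trace = 0 := by
      rw [hP1, hP2, ← mul_kronecker_mul, trace_kronecker, trace_pauliVec_mul _ _ hu, zero_mul]
    rw [hQ1, hQ2, smul_mul_smul_comm, Matrix.mul_add, Matrix.add_mul, Matrix.add_mul,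
      Matrix.mul_one, Matrix.one_mul, Matrix.mul_one, trace_smul, trace_add, trace_add, trace_add,
      t1, t2, t3, trace_one]
    simp
    norm_num
  have hPQ : ∀ P Q : Matrix TwoQubit TwoQubit ℂ, Q = (1 / 2 : ℂ) • (1 + P) →
      (ρ * P).trace.re = 2 * (ρ * Q).trace.re - 1 := by
    intro P Q hQ
    have : (ρ * Q).trace = ((1 / 2 : ℝ) : ℂ) * (1 + (ρ * P).trace) := by
      rw [hQ, Matrix.mul_smul, trace_smul, Matrix.mul_add, trace_add, Matrix.mul_one, hρ.2]
      simp
    rw [this, Complex.re_ofReal_mul, Complex.add_re, Complex.one_re]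
    ring
  rw [hB, Matrix.mul_add, Matrix.mul_smul, Matrix.mul_smul, trace_add, trace_smul, trace_smul,
    smul_eq_mul, smul_eq_mul, Complex.add_re, Complex.re_ofReal_mul, Complex.re_ofReal_mul,
    hPQ _ _ hQ1, hPQ _ _ hQ2]
  exact re_trace_mul_add_le hρ h1 h1' h2 h2' hcomm htr hS1 hS2 hs2 hs hss

/-! ### Attainment of the maximum, by compactness of the spheres. -/

theorem isGreatest_maxViolation (ρ : Matrix TwoQubit TwoQubit ℂ) :
    IsGreatest (chshValues ρ) (maxViolation ρ) := by
  let B := Metric.sphere (0 : EuclideanSpace ℝ (Fin 3)) 1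
  let f : EuclideanSpace ℝ (Fin 3) × EuclideanSpace ℝ (Fin 3) × EuclideanSpace ℝ (Fin 3)
      × EuclideanSpace ℝ (Fin 3) → ℝ :=
    fun p => ((ρ * bellOperator p.1 p.2.1 p.2.2.1 p.2.2.2).trace).re
  have hB : IsCompact B := isCompact_sphere _ _
  have himg : chshValues ρ = f '' (B ×ˢ B ×ˢ B ×ˢ B) := by
    ext x
    constructor
    · rintro ⟨a, b, c, d, ha, hb, hc, hd, rfl⟩
      exact ⟨(a, b, c, d), by simp [B, ha, hb, hc, hd], rfl⟩
    · rintro ⟨⟨a, b, c, d⟩, h, rfl⟩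
      simp only [B, Set.mem_prod, mem_sphere_zero_iff_norm] at h
      exact ⟨a, b, c, d, h.1, h.2.1, h.2.2.1, h.2.2.2, rfl⟩
  have hf : Continuous f := by
    refine Complex.continuous_re.comp (Continuous.matrix_trace ?_)
    refine Continuous.matrix_mul continuous_const ?_
    simp only [bellOperator]
    fun_prop
  have hne : B.Nonempty := ⟨EuclideanSpace.single 0 1, by simp [B]⟩
  rw [maxViolation, himg]
  exact ((hB.prod (hB.prod (hB.prod hB))).image hf).isGreatest_sSup
    ((hne.prod (hne.prod (hne.prod hne))).image f)

theorem maxViolation_le {ρ : Matrix TwoQubit TwoQubit ℂ} (hρ : IsState ρ) :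
    maxViolation ρ ≤ √(1 + concurrence ρ ^ 2) := by
  obtain ⟨a, b, c, d, ha, hb, hc, hd, h⟩ := (isGreatest_maxViolation ρ).1
  rw [h]
  exact re_trace_mul_bellOperator_le hρ ha hb hc hd

/-! ### Pure states. -/

theorem IsPureState.isState {ρ : Matrix TwoQubit TwoQubit ℂ} (hρ : IsPureState ρ) :
    IsState ρ := by
  obtain ⟨ψ, hψ, h⟩ := hρ
  have : ρ = vecMulVec ψ.ofLp (star ψ.ofLp) := by ext i j; exact h i j
  rw [this]
  refine ⟨posSemidef_vecMulVec_self_star _, ?_⟩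
  rw [trace_vecMulVec]
  have h2 : inner ℂ ψ ψ = 1 := by rw [inner_self_eq_norm_sq_to_K, hψ]; simp
  rwa [EuclideanSpace.inner_eq_star_dotProduct] at h2

theorem concurrence_vecMulVec (ψ : TwoQubit → ℂ) :
    concurrence (vecMulVec ψ (star ψ)) = ‖ψ ⬝ᵥ ((pauli 1 ⊗ₖ pauli 1) *ᵥ ψ)‖ := by
  set κ := ψ ⬝ᵥ ((pauli 1 ⊗ₖ pauli 1) *ᵥ ψ) with hκ
  set δ : TwoQubit → ℂ := Pi.single (0, 0) 1 with hδ
  -- With this rank-one factor `Wᵀ S W = κ δ δᵀ`; its only possibly nonzero singular value is `‖κ‖`,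
  -- and the phase `φ` is absorbed into the left unitary.
  set W := vecMulVec ψ δ with hW
  set φ : ℂ := Complex.exp (κ.arg * Complex.I) with hφ
  have hδδ : δ ⬝ᵥ star δ = 1 := by simp [hδ]
  have hWW : vecMulVec ψ (star ψ) = W * Wᴴ := by
    rw [hW, conjTranspose_vecMulVec, vecMulVec_mul_vecMulVec, hδδ, one_smul]
  have hφ1 : star φ * φ = 1 := by
    rw [RCLike.star_def, Complex.conj_mul', hφ, Complex.norm_exp_ofReal_mul_I]; simp
  have hτ : Wᵀ * (pauli 1 ⊗ₖ pauli 1) * W = (φ • (1 : Matrix TwoQubit TwoQubit ℂ))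
      * diagonal (fun i => (((Pi.single (0, 0) ‖κ‖ : TwoQubit → ℝ) i : ℝ) : ℂ))
      * (1 : Matrix TwoQubit TwoQubit ℂ)ᴴ := by
    rw [conjTranspose_one, Matrix.mul_one, Matrix.smul_mul, Matrix.one_mul, hW, transpose_vecMulVec,
      Matrix.mul_assoc, mul_vecMulVec, vecMulVec_mul_vecMulVec, ← hκ,
      ← Complex.norm_mul_exp_arg_mul_I κ, ← hφ]
    ext i j
    simp only [hδ, vecMulVec_apply, Matrix.smul_apply, diagonal_apply, Pi.smul_apply, smul_eq_mul,
      Pi.single_apply]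
    by_cases hi : i = (0, 0) <;> by_cases hj : j = (0, 0) <;> by_cases hij : i = j <;>
      simp_all [mul_comm]
  obtain ⟨m, hm, ⟨i, hi⟩, hC⟩ := exists_concurrence_eq W _ _ _
    (fun i => by
      by_cases h : i = (0, 0)
      · subst h; simp
      · simp [h])
    (by rw [conjTranspose_smul, conjTranspose_one, smul_mul_smul_comm, hφ1, Matrix.mul_one,
          one_smul])
    (by simp) hτ
  have hmκ : m = ‖κ‖ := by
    refine le_antisymm ?_ (by simpa using hm (0, 0))
    rw [hi]
    by_cases h : i = (0, 0)
    · subst h; simp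
    · simp [h]
  rw [hWW, hC, hmκ, Finset.sum_pi_single']
  simp only [Finset.mem_univ, if_true]
  rw [max_eq_right] <;> linarith [norm_nonneg κ]

theorem concurrence_eq_two_mul_norm_det (Ψ : Matrix (Fin 2) (Fin 2) ℂ) :
    concurrence (vecMulVec (fun p : TwoQubit => Ψ p.1 p.2) (star fun p : TwoQubit => Ψ p.1 p.2))
      = 2 * ‖Ψ.det‖ := by
  rw [concurrence_vecMulVec]
  have : (fun p : TwoQubit => Ψ p.1 p.2) ⬝ᵥ
      ((pauli 1 ⊗ₖ pauli 1) *ᵥ fun p : TwoQubit => Ψ p.1 p.2) = -(2 * Ψ.det) := by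
    simp only [dotProduct, mulVec, Fintype.sum_prod_type, Fin.sum_univ_two, kroneckerMap_apply,
      det_fin_two]
    simp [pauli]
    ring
  rw [this, norm_neg, norm_mul]
  simp

theorem trace_vecMulVec_mul_kronecker (Ψ X Y : Matrix (Fin 2) (Fin 2) ℂ) :
    (vecMulVec (fun p : TwoQubit => Ψ p.1 p.2) (star fun p : TwoQubit => Ψ p.1 p.2)
      * (X ⊗ₖ Y)).trace = (Ψᴴ * X * Ψ * Yᵀ).trace := by
  simp only [trace, diag_apply, Matrix.mul_apply, Fintype.sum_prod_type, Fin.sum_univ_two,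
    kroneckerMap_apply, vecMulVec_apply, Pi.star_apply, conjTranspose_apply, transpose_apply]
  ring

/-- A pure state attains the value `√(1 + C²)`. -/
theorem le_maxViolation_of_isPureState {ρ : Matrix TwoQubit TwoQubit ℂ} (hρ : IsPureState ρ) :
    √(1 + concurrence ρ ^ 2) ≤ maxViolation ρ := by
  have htr := hρ.isState.2
  obtain ⟨ψ, -, h⟩ := hρ
  set Ψ : Matrix (Fin 2) (Fin 2) ℂ := fun i j => ψ (i, j) with hΨ
  obtain rfl : ρ = vecMulVec (fun p : TwoQubit => Ψ p.1 p.2)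
    (star fun p : TwoQubit => Ψ p.1 p.2) := by ext i j; exact h i j
  obtain ⟨U, V, s, hU, hU', hV, hV', hs, hsvd⟩ := Ψ.exists_svd
  change Ψ = U * diagonal (fun i => (s i : ℂ)) * Vᴴ at hsvd
  set D : Matrix (Fin 2) (Fin 2) ℂ := diagonal (fun i => (s i : ℂ)) with hD
  have hDH : Dᴴ = D := by
    rw [hD, diagonal_conjTranspose]; congr 1; ext i; simp
  -- Passage to the Schmidt basis. The second factor enters the trace formula transposed, so it is
  -- conjugated by the entrywise conjugate `Vᴴᵀ` of `V`.
  have hexp : ∀ x y : Matrix (Fin 2) (Fin 2) ℂ,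
      (vecMulVec (fun p : TwoQubit => Ψ p.1 p.2) (star fun p : TwoQubit => Ψ p.1 p.2)
        * ((U * x * Uᴴ) ⊗ₖ (Vᴴᵀ * y * Vᴴᵀᴴ))).trace = (D * x * D * yᵀ).trace := by
    intro x y
    have hVV : Vᴴᵀᴴᵀ = V := by ext i j; simp
    rw [trace_vecMulVec_mul_kronecker, hsvd, transpose_mul, transpose_mul, transpose_transpose, hVV]
    calc _ = (V * (D * (Uᴴ * U) * x * (Uᴴ * U) * D * (Vᴴ * V) * yᵀ * Vᴴ)).trace := by
          simp only [conjTranspose_mul, conjTranspose_conjTranspose, hDH, Matrix.mul_assoc]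
      _ = _ := by
        rw [trace_mul_comm, hU', hV', Matrix.mul_one, Matrix.mul_one, Matrix.mul_one,
          Matrix.mul_assoc _ Vᴴ, hV', Matrix.mul_one]
  have hVu : Vᴴᵀ * Vᴴᵀᴴ = 1 ∧ Vᴴᵀᴴ * Vᴴᵀ = 1 := by
    have h0 : Vᴴᵀᴴ = Vᵀ := by ext i j; simp
    rw [h0, ← transpose_mul, ← transpose_mul, hV, hV', transpose_one]
    exact ⟨rfl, rfl⟩
  have hss : s 0 ^ 2 + s 1 ^ 2 = 1 := by
    have h1 := hexp 1 1
    rw [Matrix.mul_one, Matrix.mul_one, hU, hVu.1, one_kronecker_one, Matrix.mul_one, htr,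
      transpose_one, Matrix.mul_one, Matrix.mul_one, hD, diagonal_mul_diagonal, trace_diagonal,
      Fin.sum_univ_two] at h1
    rw [sq, sq]
    exact_mod_cast h1.symm
  have hdet : concurrence (vecMulVec (fun p : TwoQubit => Ψ p.1 p.2)
      (star fun p : TwoQubit => Ψ p.1 p.2)) = 2 * s 0 * s 1 := by
    have hnd : ∀ T : Matrix (Fin 2) (Fin 2) ℂ, Tᴴ * T = 1 → ‖T.det‖ = 1 := by
      intro T hT
      have := congrArg (fun A => ‖A.det‖) hT
      simp only [det_mul, det_conjTranspose, norm_mul, norm_star, det_one, norm_one] at this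
      nlinarith [norm_nonneg T.det]
    rw [concurrence_eq_two_mul_norm_det, hsvd, det_mul, det_mul, det_conjTranspose, norm_mul,
      norm_mul, norm_star, hnd U hU', hnd V hV', hD, det_diagonal, Fin.prod_univ_two, norm_mul,
      Complex.norm_real, Complex.norm_real, Real.norm_of_nonneg (hs 0), Real.norm_of_nonneg (hs 1)]
    ring
  set C := concurrence (vecMulVec (fun p : TwoQubit => Ψ p.1 p.2)
      (star fun p : TwoQubit => Ψ p.1 p.2)) with hC
  set N := √(1 + C ^ 2) with hN
  have hN2 : N ^ 2 = 1 + C ^ 2 := Real.sq_sqrt (by positivity)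
  have hN0 : 0 < N := Real.sqrt_pos.2 (by positivity)
  -- For `t = ±1` these vectors have sum `2z/N` and difference `2Cx/N`. With `a = z` and `b = x`,
  -- the Bell operator is `(σ_z ⊗ σ_z + C σ_x ⊗ σ_x)/N` in the Schmidt basis, with expectations `s₀²
  -- + s₁² = 1` and `2 s₀ s₁ = C` of the two terms.
  have hunit : ∀ t : ℝ, t ^ 2 = 1 →
      (![t * (C / N), 0, 1 / N] : Fin 3 → ℝ) ⬝ᵥ ![t * (C / N), 0, 1 / N] = 1 := by
    intro t ht
    simp only [dotProduct, Fin.sum_univ_three]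
    simp
    field_simp
    rw [hN2]
    linear_combination C ^ 2 * ht
  obtain ⟨a, ha, hpa⟩ := exists_pauliVec_conj U hU hU' ![0, 0, 1]
    (by simp [dotProduct, Fin.sum_univ_three])
  obtain ⟨b, hb, hpb⟩ := exists_pauliVec_conj U hU hU' ![1, 0, 0]
    (by simp [dotProduct, Fin.sum_univ_three])
  obtain ⟨c, hc, hpc⟩ := exists_pauliVec_conj Vᴴᵀ hVu.1 hVu.2 _ (hunit 1 (by norm_num))
  obtain ⟨d, hd, hpd⟩ := exists_pauliVec_conj Vᴴᵀ hVu.1 hVu.2 _ (hunit (-1) (by norm_num))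
  refine (isGreatest_maxViolation _).2 ⟨WithLp.toLp 2 a, WithLp.toLp 2 b, WithLp.toLp 2 c,
    WithLp.toLp 2 d, (norm_eq_one_iff_dotProduct _).2 ha, (norm_eq_one_iff_dotProduct _).2 hb,
    (norm_eq_one_iff_dotProduct _).2 hc, (norm_eq_one_iff_dotProduct _).2 hd, ?_⟩
  rw [bellOperator_eq, hpa, hpb, hpc, hpd, ← Matrix.add_mul, ← Matrix.sub_mul, ← Matrix.mul_add,
    ← Matrix.mul_sub, Matrix.mul_smul, Matrix.mul_add, trace_smul, trace_add, hexp, hexp]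
  simp only [pauliVec_eq, hD, trace_fin_two, Matrix.mul_apply, Fin.sum_univ_two, diagonal_apply]
  simp
  norm_cast
  calc N = (1 + C * C) / N := by rw [eq_div_iff hN0.ne', ← sq, hN2, sq]
    _ = ((s 0 ^ 2 + s 1 ^ 2) + C * (2 * s 0 * s 1)) / N := by rw [hss, ← hdet]
    _ = _ := by ring

theorem exists_isPureState_concurrence_eq {C : ℝ} (hC : C ∈ Set.Icc (0 : ℝ) 1) :
    ∃ ρ : Matrix TwoQubit TwoQubit ℂ, IsPureState ρ ∧ concurrence ρ = C := by
  -- The state `cos t |00⟩ + sin t |11⟩` has concurrence `sin 2t`.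
  set t := Real.arcsin C / 2 with ht
  have hsin : 2 * Real.sin t * Real.cos t = C := by
    rw [← Real.sin_two_mul, ht, mul_div_cancel₀ _ two_ne_zero,
      Real.sin_arcsin (by linarith [hC.1]) hC.2]
  set Ψ : Matrix (Fin 2) (Fin 2) ℂ := !![(Real.cos t : ℂ), 0; 0, (Real.sin t : ℂ)] with hΨ
  refine ⟨vecMulVec (fun p : TwoQubit => Ψ p.1 p.2) (star fun p : TwoQubit => Ψ p.1 p.2),
    ⟨WithLp.toLp 2 fun p => Ψ p.1 p.2, ?_, fun i j => rfl⟩, ?_⟩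
  · rw [EuclideanSpace.norm_eq, Real.sqrt_eq_one, Fintype.sum_prod_type]
    simp only [Fin.sum_univ_two, hΨ, of_apply, cons_val_zero, cons_val_one, cons_val_fin_one,
      Complex.norm_real, norm_zero, Real.norm_eq_abs, sq_abs]
    linarith [Real.sin_sq_add_cos_sq t]
  · rw [concurrence_eq_two_mul_norm_det, hΨ, det_fin_two_of, mul_zero, sub_zero,
      ← Complex.ofReal_mul, Complex.norm_real, Real.norm_of_nonneg (by linarith [hC.1])]
    linarith

end CHSH

theorem theorem1 :
    -- for every state, `β` is an attained maximum, `C` lies in `[0, 1]`, and `β ≤ √(1 + C²)`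
    (∀ ρ : Matrix CHSH.TwoQubit CHSH.TwoQubit ℂ, CHSH.IsState ρ →
      IsGreatest (CHSH.chshValues ρ) (CHSH.maxViolation ρ) ∧
      CHSH.concurrence ρ ∈ Set.Icc (0 : ℝ) 1 ∧
      CHSH.maxViolation ρ ≤ √(1 + CHSH.concurrence ρ ^ 2)) ∧
    -- every pure state attains the bound
    (∀ ρ : Matrix CHSH.TwoQubit CHSH.TwoQubit ℂ, CHSH.IsPureState ρ →
      CHSH.maxViolation ρ = √(1 + CHSH.concurrence ρ ^ 2)) ∧
    -- every `C ∈ [0, 1]` is the concurrence of a pure state, and `√(1 + C²)` is the maximum of `β`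
    -- over all states of concurrence `C`
    (∀ C ∈ Set.Icc (0 : ℝ) 1,
      (∃ ρ : Matrix CHSH.TwoQubit CHSH.TwoQubit ℂ, CHSH.IsPureState ρ ∧ CHSH.concurrence ρ = C) ∧
      IsGreatest {x : ℝ | ∃ ρ : Matrix CHSH.TwoQubit CHSH.TwoQubit ℂ,
        CHSH.IsState ρ ∧ CHSH.concurrence ρ = C ∧ CHSH.maxViolation ρ = x} (√(1 + C ^ 2))) := by
  have hpure : ∀ ρ : Matrix CHSH.TwoQubit CHSH.TwoQubit ℂ, CHSH.IsPureState ρ →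
      CHSH.maxViolation ρ = √(1 + CHSH.concurrence ρ ^ 2) := fun ρ hρ =>
    le_antisymm (CHSH.maxViolation_le hρ.isState) (CHSH.le_maxViolation_of_isPureState hρ)
  refine ⟨fun ρ hρ => ⟨CHSH.isGreatest_maxViolation ρ, CHSH.concurrence_mem_Icc hρ,
    CHSH.maxViolation_le hρ⟩, hpure, fun C hC => ?_⟩
  obtain ⟨ρ, hρ, hρC⟩ := CHSH.exists_isPureState_concurrence_eq hC
  refine ⟨⟨ρ, hρ, hρC⟩, ⟨ρ, hρ.isState, hρC, by rw [hpure ρ hρ, hρC]⟩, ?_⟩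
  rintro x ⟨ρ', hρ', rfl, rfl⟩
  exact CHSH.maxViolation_le hρ'
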